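/- Let $\mathcal C$ be a rigid C*-tensor category (closed under finite direct sums and subobjects) with simple unit object $\mathbb 1$ and at most countably many isomorphism classes of simple objects. Fix a set $\mathrm{Irr}\ni\mathbb 1$ of representatives of these classes, and for every $k\in\mathrm{Irr}$, with $\bar k\in\mathrm{Irr}$ the representative of its conjugate, a standard solution $R_k:\mathbb 1\to\bar k\otimes k$, $\bar R_k:\mathbb 1\to k\otimes\bar k$ of the conjugate equations. The fusion algebra $\mathbb C[\mathcal C]$ is the unital $*$-algebra with basis $\{[k]\}_{k\in\mathrm{Irr}}$, product $[x][y]=\sum_{z}\dim\mathcal C(z,x\otimes y)\,[z]$ and $[x]^*=[\bar x]$ (extended conjugate-linearly). For objects $x,y$ put $\mathcal A_{x,y}=\bigoplus_{w\in\mathrm{Irr}}\mathcal C(w\otimes x,y\otimes w)$; for $x,y\in\mathrm{Irr}$ these are the corners of the tube algebra $\mathcal A=\bigoplus_{x,y\in\mathrm{Irr}}\mathcal A_{x,y}$. For an object $z$ and $\gamma\in\mathcal C(z\otimes x,y\otimes z)$ let $\Psi^z_{x,y}(\gamma)\in\mathcal A_{x,y}$ have the components $\sum_{\alpha}(1_y\otimes\alpha^*)\gamma(\alpha\otimes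 1_x)$, $w\in\mathrm{Irr}$, where $\alpha$ runs over an orthonormal basis of $\mathcal C(w,z)$ for the inner product $\langle\sigma,\tau\rangle 1_w=\tau^*\sigma$. The product $\mathcal A_{y,z}\times\mathcal A_{x,y}\to\mathcal A_{x,z}$ and the involution $\mathcal A_{x,y}\to\mathcal A_{y,x}$ are the biadditive, respectively additive, extensions of $$\gamma_1\cdot\gamma_2=\Psi^{m\otimes l}_{x,z}\big((\gamma_1\otimes 1_l)(1_m\otimes\gamma_2)\big),\qquad \gamma^{\#}=(R_k^*\otimes 1_x\otimes 1_{\bar k})(1_{\bar k}\otimes\gamma^*\otimes 1_{\bar k})(1_{\bar k}\otimes 1_y\otimes\bar R_k)\in\mathcal C(\bar k\otimes y,x\otimes\bar k)$$ for $\gamma_1\in\mathcal C(m\otimes y,z\otimes m)$, $\gamma_2\in\mathcal C(l\otimes x,y\otimes l)$, $\gamma\in\mathcal C(k\otimes x,y\otimes k)$ and $k,l,m\in\mathrm{Irr}$; the involution is the additive extension of $\gamma\mapsto\gamma^{\#}$ and is again written $*$ below. Identify $\mathbb C[\mathcal C]$ with $\mathcal A_{\mathbb 1,\mathbb 1}$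 by $[k]\mapsto\Psi^k_{\mathbb 1,\mathbb 1}(1_k)$, and let $p_{\mathbb 1}=1_{\mathbb 1}\in\mathcal C(\mathbb 1\otimes\mathbb 1,\mathbb 1\otimes\mathbb 1)\subset\mathcal A_{\mathbb 1,\mathbb 1}$. The tube cone is $$\Sigma^2\mathcal C=\Big\{\sum_{i=1}^n a_ia_i^*:\ n\in\mathbb N,\ a_i\in\mathcal A_{x_i,\mathbb 1},\ x_i\in\mathrm{Irr}\Big\}.$$ A linear functional $\varphi:\mathcal A_{\mathbb 1,\mathbb 1}\to\mathbb C$ is a weight-$\mathbb 1$ annular state if $\varphi(p_{\mathbb 1})=1$ and $\varphi(f^*\cdot f)\ge 0$ for all $m\in\mathrm{Irr}$ and $f\in\mathcal A_{\mathbb 1,m}$. Let $\pi:\mathbb C[\mathcal C]\to B(H)$ be a $*$-representation on a Hilbert space $H$ which is non-degenerate, i.e. $\pi(a)\xi=0$ for all $a\in\mathbb C[\mathcal C]$ implies $\xi=0$. Then the following are equivalent: (i) $\pi$ is weight-$\mathbb 1$ admissible: for every unit vector $\xi\in H$ the vector state $a\mapsto\langle\pi(a)\xi,\xi\rangle$ is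 a weight-$\mathbb 1$ annular state; (ii) $\pi$ is $\Sigma^2\mathcal C$-positive: $\pi$ is unital and $\pi(y)\ge 0$ in $B(H)$ for all $y\in\Sigma^2\mathcal C$. -/

import Mathlib

open CategoryTheory MonoidalCategory
open scoped ComplexOrder

universe u v w

noncomputable section

namespace TubeAlgebra

/-! ### Rigid C*-tensor categories -/

/-- A C*-category: a `ℂ`-linear category with a conjugate-linear involution `f ↦ f*` reversing
arrows and complete submultiplicative norms on the morphism spaces satisfying the C*-identity, in
which every `f* f` is a positive element of the C*-algebra of endomorphisms of the source.
In diagrammatic order, `f* f` is `f ≫ dag f` and `f f*` is `dag f ≫ f`. -/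
class CStarCategory (C : Type u) [Category.{v} C] [Preadditive C] [Linear ℂ C] where
  /-- The involution `f ↦ f*`. -/
  dag : ∀ {X Y : C}, (X ⟶ Y) → (Y ⟶ X)
  dag_dag : ∀ {X Y : C} (f : X ⟶ Y), dag (dag f) = f
  dag_comp : ∀ {X Y Z : C} (f : X ⟶ Y) (g : Y ⟶ Z), dag (f ≫ g) = dag g ≫ dag f
  dag_add : ∀ {X Y : C} (f g : X ⟶ Y), dag (f + g) = dag f + dag g
  dag_smul : ∀ {X Y : C} (c : ℂ) (f : X ⟶ Y), dag (c • f) = (starRingEnd ℂ c) • dag f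
  /-- The norms of the morphism spaces. -/
  homNorm : ∀ X Y : C, Seminorm ℂ (X ⟶ Y)
  eq_zero_of_homNorm : ∀ {X Y : C} (f : X ⟶ Y), homNorm X Y f = 0 → f = 0
  complete : ∀ {X Y : C} (s : ℕ → (X ⟶ Y)),
    (∀ ε : ℝ, 0 < ε → ∃ N : ℕ, ∀ m ≥ N, ∀ n ≥ N, homNorm X Y (s m - s n) < ε) →
    ∃ l : X ⟶ Y, ∀ ε : ℝ, 0 < ε → ∃ N : ℕ, ∀ n ≥ N, homNorm X Y (s n - l) < ε
  homNorm_comp_le : ∀ {X Y Z : C} (f : X ⟶ Y) (g : Y ⟶ Z),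
    homNorm X Z (f ≫ g) ≤ homNorm X Y f * homNorm Y Z g
  homNorm_comp_dag : ∀ {X Y : C} (f : X ⟶ Y), homNorm X X (f ≫ dag f) = homNorm X Y f ^ 2
  comp_dag_pos : ∀ {X Y : C} (f : X ⟶ Y), ∃ g : X ⟶ X, f ≫ dag f = g ≫ dag g

open CStarCategory (dag)

/-- A C*-tensor category, closed under finite direct sums and under passage to subobjects. The
associativity and unit constraints are unitary, and trivial in the strict case. -/
class CStarTensorCategory (C : Type u) [Category.{v} C] [Preadditive C] [Linear ℂ C]
    [MonoidalCategory C] [MonoidalPreadditive C] [MonoidalLinear ℂ C] extends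
    CStarCategory C where
  dag_whiskerLeft : ∀ (X : C) {Y Z : C} (f : Y ⟶ Z), dag (X ◁ f) = X ◁ dag f
  dag_whiskerRight : ∀ {X Y : C} (f : X ⟶ Y) (Z : C), dag (f ▷ Z) = dag f ▷ Z
  dag_associator : ∀ X Y Z : C, dag (α_ X Y Z).hom = (α_ X Y Z).inv
  dag_leftUnitor : ∀ X : C, dag (λ_ X).hom = (λ_ X).inv
  dag_rightUnitor : ∀ X : C, dag (ρ_ X).hom = (ρ_ X).inv
  exists_sum : ∀ X Y : C, ∃ (Z : C) (i : X ⟶ Z) (j : Y ⟶ Z),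
    i ≫ dag i = 𝟙 X ∧ j ≫ dag j = 𝟙 Y ∧ dag i ≫ i + dag j ≫ j = 𝟙 Z
  exists_subobject : ∀ (X : C) (p : X ⟶ X), p ≫ p = p → dag p = p →
    ∃ (Y : C) (i : Y ⟶ X), i ≫ dag i = 𝟙 Y ∧ dag i ≫ i = p

section Conj

variable {C : Type u} [Category.{v} C] [Preadditive C] [Linear ℂ C]
  [MonoidalCategory C] [MonoidalPreadditive C] [MonoidalLinear ℂ C]

/-- An object is simple when its endomorphisms are the scalars and it is not a zero object. -/
def IsSimpleObject (X : C) : Prop :=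
  𝟙 X ≠ 0 ∧ ∀ f : X ⟶ X, ∃ c : ℂ, f = c • 𝟙 X

/-- `(R, Rb)` solves the conjugate equations for `(X, Xb)`:
`(1 ⊗ Rb*)(R ⊗ 1) = 1` on `Xb` and `(1 ⊗ R*)(Rb ⊗ 1) = 1` on `X`. -/
def IsConjugateSolution [CStarTensorCategory C] {X Xb : C}
    (R : 𝟙_ C ⟶ Xb ⊗ X) (Rb : 𝟙_ C ⟶ X ⊗ Xb) : Prop :=
  ((λ_ Xb).inv ≫ R ▷ Xb ≫ (α_ Xb X Xb).hom ≫ Xb ◁ dag Rb ≫ (ρ_ Xb).hom = 𝟙 Xb) ∧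
  ((λ_ X).inv ≫ Rb ▷ X ≫ (α_ X Xb X).hom ≫ X ◁ dag R ≫ (ρ_ X).hom = 𝟙 X)

/-- A standard solution: moreover `R* (1 ⊗ f) R = Rb* (f ⊗ 1) Rb` for all `f ∈ End X`. -/
def IsStandardSolution [CStarTensorCategory C] {X Xb : C}
    (R : 𝟙_ C ⟶ Xb ⊗ X) (Rb : 𝟙_ C ⟶ X ⊗ Xb) : Prop :=
  IsConjugateSolution R Rb ∧
  ∀ f : X ⟶ X, R ≫ Xb ◁ f ≫ dag R = Rb ≫ f ▷ Xb ≫ dag Rb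

end Conj

/-- A rigid C*-tensor category: every object has a conjugate. -/
class RigidCStarTensorCategory (C : Type u) [Category.{v} C] [Preadditive C] [Linear ℂ C]
    [MonoidalCategory C] [MonoidalPreadditive C] [MonoidalLinear ℂ C] extends
    CStarTensorCategory C where
  exists_conjugate : ∀ X : C, ∃ (Xb : C) (R : 𝟙_ C ⟶ Xb ⊗ X) (Rb : 𝟙_ C ⟶ X ⊗ Xb),
    IsConjugateSolution R Rb

/-- A choice of representatives of the isomorphism classes of simple objects, the unit object
representing its own class, and of a standard solution of the conjugate equations for each
representative and its conjugate representative. -/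
structure IrrSystem (C : Type u) [Category.{v} C] [Preadditive C] [Linear ℂ C]
    [MonoidalCategory C] [MonoidalPreadditive C] [MonoidalLinear ℂ C]
    [RigidCStarTensorCategory C] where
  /-- The set of representatives. -/
  Irr : Set C
  unit_mem : 𝟙_ C ∈ Irr
  simple : ∀ x ∈ Irr, IsSimpleObject x
  exists_iso : ∀ x : C, IsSimpleObject x → ∃ y ∈ Irr, Nonempty (x ≅ y)
  eq_of_iso : ∀ x ∈ Irr, ∀ y ∈ Irr, Nonempty (x ≅ y) → x = y
  /-- The representative of the conjugate. -/
  conj : Irr → Irr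
  /-- The morphism `R : 1 ⟶ x̄ ⊗ x` of the chosen solution. -/
  R : ∀ x : Irr, 𝟙_ C ⟶ (conj x : C) ⊗ (x : C)
  /-- The morphism `R̄ : 1 ⟶ x ⊗ x̄` of the chosen solution. -/
  Rbar : ∀ x : Irr, 𝟙_ C ⟶ (x : C) ⊗ (conj x : C)
  standard : ∀ x : Irr, IsStandardSolution (R x) (Rbar x)

variable {C : Type u} [Category.{v} C] [Preadditive C] [Linear ℂ C]
  [MonoidalCategory C] [MonoidalPreadditive C] [MonoidalLinear ℂ C]
  [RigidCStarTensorCategory C]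

/-- The unit object as an element of `Irr`. -/
def IrrSystem.unit (S : IrrSystem C) : S.Irr := ⟨𝟙_ C, S.unit_mem⟩

/-! ### The fusion algebra -/

/-- The fusion algebra `ℂ[C]`: formal complex combinations of the simple objects. -/
def FusionAlgebra (S : IrrSystem C) : Type u := S.Irr →₀ ℂ

namespace FusionAlgebra

variable {S : IrrSystem C}

instance : AddCommGroup (FusionAlgebra S) := inferInstanceAs (AddCommGroup (S.Irr →₀ ℂ))

instance : Module ℂ (FusionAlgebra S) := inferInstanceAs (Module ℂ (S.Irr →₀ ℂ))

/-- The basis element `[x]`. -/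
def basis (x : S.Irr) : FusionAlgebra S := Finsupp.single x (1 : ℂ)

/-- The product of two basis elements by the fusion rules, `[x] [y] = ∑ z, dim C(z, x ⊗ y) [z]`
(a finite sum, as `x ⊗ y` is a finite direct sum of simple objects). -/
def fuse (x y : S.Irr) : FusionAlgebra S :=
  ∑ᶠ z : S.Irr, (Module.finrank ℂ ((z : C) ⟶ (x : C) ⊗ (y : C)) : ℂ) • basis z

/-- The bilinear extension of the fusion rules. -/
def mulHom (S : IrrSystem C) : FusionAlgebra S →ₗ[ℂ] FusionAlgebra S →ₗ[ℂ] FusionAlgebra S :=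
  Finsupp.lift (FusionAlgebra S →ₗ[ℂ] FusionAlgebra S) ℂ S.Irr fun x =>
    Finsupp.lift (FusionAlgebra S) ℂ S.Irr fun y => fuse x y

instance : NonUnitalNonAssocRing (FusionAlgebra S) where
  mul a b := mulHom S a b
  left_distrib a b c := (mulHom S a).map_add b c
  right_distrib a b c := by
    change mulHom S (a + b) c = mulHom S a c + mulHom S b c
    rw [map_add, LinearMap.add_apply]
  zero_mul a := by
    change mulHom S 0 a = 0
    rw [map_zero, LinearMap.zero_apply]
  mul_zero a := (mulHom S a).map_zero

instance : One (FusionAlgebra S) := ⟨basis S.unit⟩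

/-- The involution: the conjugate-linear extension of `[x] ↦ [x̄]`. -/
instance : Star (FusionAlgebra S) :=
  ⟨fun a => Finsupp.sum (show S.Irr →₀ ℂ from a) fun x c => (starRingEnd ℂ c) • basis (S.conj x)⟩

end FusionAlgebra

/-! ### The tube algebra -/

/-- The corner `A_{x,y}` of the tube algebra, the direct sum over `w ∈ Irr` of `C(w ⊗ x, y ⊗ w)`.
The tube algebra is the direct sum of the `A_{x,y}` over `x, y ∈ Irr`. -/
abbrev Tube (S : IrrSystem C) (x y : C) : Type (max u v) :=
  Π₀ k : S.Irr, ((k : C) ⊗ x ⟶ y ⊗ (k : C))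

/-- For `k` simple, `B` is an orthonormal basis of `C(k, z)` for the inner product
`⟨σ, τ⟩ 1 = τ* σ`. -/
def IsOrthonormalBasis {k z : C} (B : Finset (k ⟶ z)) : Prop :=
  (∀ a ∈ B, a ≫ dag a = 𝟙 k) ∧ (∀ a ∈ B, ∀ b ∈ B, a ≠ b → a ≫ dag b = 0) ∧
  Submodule.span ℂ (B : Set (k ⟶ z)) = ⊤

/-- A chosen orthonormal basis of `C(k, z)` for `k` simple. It exists, as the morphism spaces of a
rigid C*-tensor category with simple unit are finite-dimensional. -/
def onb (k z : C) : Finset (k ⟶ z) := Classical.epsilon IsOrthonormalBasis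

variable (S : IrrSystem C)

open scoped Classical in
/-- The map `Ψ^z_{x,y} : C(z ⊗ x, y ⊗ z) → A_{x,y}`, whose component at `w ∈ Irr` is
`∑ (1 ⊗ a*) γ (a ⊗ 1)`, the sum over an orthonormal basis of `C(w, z)`. It does not depend on the
orthonormal bases, and only finitely many components are non-zero. -/
def tubePsi {x y : C} (z : C) (γ : z ⊗ x ⟶ y ⊗ z) : Tube S x y :=
  ∑ᶠ k : S.Irr, DFinsupp.single k (∑ a ∈ onb (k : C) z, a ▷ x ≫ γ ≫ y ◁ dag a)

variable {S}

open scoped Classical in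
/-- The product `A_{y,z} × A_{x,y} → A_{x,z}` of the tube algebra, the biadditive extension of
`(γ₁, γ₂) ↦ Ψ^{m ⊗ l}((γ₁ ⊗ 1)(1 ⊗ γ₂))` for `γ₁ ∈ C(m ⊗ y, z ⊗ m)`, `γ₂ ∈ C(l ⊗ x, y ⊗ l)`. -/
def tubeMul {x y z : C} (a : Tube S y z) (b : Tube S x y) : Tube S x z :=
  ∑ m ∈ a.support, ∑ l ∈ b.support,
    tubePsi S ((m : C) ⊗ (l : C))
      ((α_ (m : C) (l : C) x).hom ≫ (m : C) ◁ b l ≫ (α_ (m : C) y (l : C)).inv ≫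
        a m ▷ (l : C) ≫ (α_ z (m : C) (l : C)).hom)

/-- For `γ ∈ C(k ⊗ x, y ⊗ k)`, the morphism `(R* ⊗ 1)(1 ⊗ γ* ⊗ 1)(1 ⊗ R̄)` in
`C(k̄ ⊗ y, x ⊗ k̄)`. -/
def rotate {x y : C} (k : S.Irr) (γ : (k : C) ⊗ x ⟶ y ⊗ (k : C)) :
    (S.conj k : C) ⊗ y ⟶ x ⊗ (S.conj k : C) :=
  (S.conj k : C) ◁ ((ρ_ y).inv ≫ y ◁ S.Rbar k ≫ (α_ y (k : C) (S.conj k : C)).inv ≫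
      dag γ ▷ (S.conj k : C) ≫ (α_ (k : C) x (S.conj k : C)).hom) ≫
    (α_ (S.conj k : C) (k : C) (x ⊗ (S.conj k : C))).inv ≫
    dag (S.R k) ▷ (x ⊗ (S.conj k : C)) ≫ (λ_ (x ⊗ (S.conj k : C))).hom

open scoped Classical in
/-- The involution `A_{x,y} → A_{y,x}` of the tube algebra. -/
def tubeStar {x y : C} (a : Tube S x y) : Tube S y x :=
  ∑ k ∈ a.support, DFinsupp.single (S.conj k) (rotate k (a k))

open scoped Classical in
/-- The projection `p_m ∈ A_{m,m}`, the identity of `m` in the component of the unit object. -/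
def tubeProj (S : IrrSystem C) (m : C) : Tube S m m :=
  DFinsupp.single S.unit ((λ_ m).hom ≫ (ρ_ m).inv)

/-- The identity of `k` as an element of `C(k ⊗ 1, 1 ⊗ k)`. -/
def unitBox (k : C) : k ⊗ 𝟙_ C ⟶ 𝟙_ C ⊗ k := (ρ_ k).hom ≫ (λ_ k).inv

theorem unitBox_bijective (k : S.Irr) :
    Function.Bijective (LinearMap.toSpanSingleton ℂ _ (unitBox (k : C))) := by
  obtain ⟨h0, h1⟩ := S.simple k.1 k.2
  have key : ∀ c : ℂ, (ρ_ (k : C)).inv ≫ (c • unitBox (k : C)) ≫ (λ_ (k : C)).hom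
      = c • 𝟙 (k : C) := by
    intro c
    simp [unitBox]
  constructor
  · rw [injective_iff_map_eq_zero]
    intro c hc
    rw [LinearMap.toSpanSingleton_apply] at hc
    have h := key c
    rw [hc] at h
    simp only [Limits.zero_comp, Limits.comp_zero] at h
    exact (smul_eq_zero.mp h.symm).resolve_right h0
  · intro f
    obtain ⟨c, hc⟩ := h1 ((ρ_ (k : C)).inv ≫ f ≫ (λ_ (k : C)).hom)
    refine ⟨c, ?_⟩
    have h := (key c).trans hc.symm
    rw [LinearMap.toSpanSingleton_apply]
    have h' := congrArg (fun g => (ρ_ (k : C)).hom ≫ g ≫ (λ_ (k : C)).inv) h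
    simpa only [Category.assoc, Iso.hom_inv_id_assoc, Iso.hom_inv_id, Category.comp_id] using h'

open scoped Classical in
/-- The identification of `ℂ[C]` with `A_{1,1}`, which sends `[k]` to `Ψ^k(1_k)`, the element with
the single component `1_k` at `k`. -/
def fusionEquiv (S : IrrSystem C) : FusionAlgebra S ≃ₗ[ℂ] Tube S (𝟙_ C) (𝟙_ C) :=
  (show (S.Irr →₀ ℂ) ≃ₗ[ℂ] Tube S (𝟙_ C) (𝟙_ C) from
    (finsuppLequivDFinsupp (M := ℂ) ℂ).trans
      (DFinsupp.mapRange.linearEquiv fun k : S.Irr =>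
        LinearEquiv.ofBijective (LinearMap.toSpanSingleton ℂ _ (unitBox (k : C)))
          (unitBox_bijective k)))

/-- The tube cone, as a subset of `ℂ[C]`: the finite sums of elements `a a*`, where each `a` lies
in some `A_{x,1}` with `x ∈ Irr`. -/
def tubeCone (S : IrrSystem C) : Set (FusionAlgebra S) :=
  {y | ∃ (n : ℕ) (x : Fin n → S.Irr) (a : ∀ i, Tube S (x i : C) (𝟙_ C)),
    fusionEquiv S y = ∑ i, tubeMul (a i) (tubeStar (a i))}

/-- Annular states of weight `1`: linear functionals `φ` on `A_{1,1}` with `φ(p_1) = 1` and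
`φ(f* f) ≥ 0` for all `f ∈ A_{1,m}` and `m ∈ Irr`. -/
def IsAnnularState (φ : Tube S (𝟙_ C) (𝟙_ C) →ₗ[ℂ] ℂ) : Prop :=
  φ (tubeProj S (𝟙_ C)) = 1 ∧
  ∀ (m : S.Irr) (f : Tube S (𝟙_ C) (m : C)), 0 ≤ φ (tubeMul (tubeStar f) f)

/-! ### Representations of the fusion algebra -/

variable {H : Type w} [NormedAddCommGroup H] [InnerProductSpace ℂ H] [CompleteSpace H]

/-- Non-degenerate `*`-representations. -/
def IsNonDegenerate (π : FusionAlgebra S →⋆ₙₐ[ℂ] (H →L[ℂ] H)) : Prop :=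
  ∀ ξ : H, (∀ a, π a ξ = 0) → ξ = 0

/-- The functional `a ↦ ⟨π(a) ξ, ξ⟩` (linear in `a`), on `ℂ[C]` identified with `A_{1,1}`. -/
def vectorFunctional (π : FusionAlgebra S →⋆ₙₐ[ℂ] (H →L[ℂ] H)) (ξ : H) :
    Tube S (𝟙_ C) (𝟙_ C) →ₗ[ℂ] ℂ where
  toFun a := inner ℂ ξ (π ((fusionEquiv S).symm a) ξ)
  map_add' a b := by simp
  map_smul' c a := by simp

/-- Weight-`1` admissibility: every vector state is an annular state of weight `1`. -/
def IsAdmissible (π : FusionAlgebra S →⋆ₙₐ[ℂ] (H →L[ℂ] H)) : Prop :=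
  ∀ ξ : H, ‖ξ‖ = 1 → IsAnnularState (vectorFunctional π ξ)

/-- Positivity for the tube cone: `π` is unital and maps the tube cone to positive operators. -/
def IsTubePositive (π : FusionAlgebra S →⋆ₙₐ[ℂ] (H →L[ℂ] H)) : Prop :=
  π 1 = 1 ∧ ∀ y ∈ tubeCone S, (π y).IsPositive

end TubeAlgebra

end

/-!
Both conditions ask that `⟨π(y) ξ, ξ⟩ ≥ 0` for certain `y ∈ A_{1,1}`: for all `f* f` with
`f ∈ A_{1,m}` in the case of admissibility, for all sums of elements `a a*` with `a ∈ A_{x,1}` in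
the case of the tube cone. Hence the point is that the involution of the tube algebra squares to
the identity (`tubeStar_tubeStar`): then `f* f = a a*` for `a = f*`, and `a a* = f* f` for
`f = a*`. Non-negativity on unit vectors gives non-negativity on all vectors by scaling, and a
bounded operator on a complex Hilbert space with non-negative quadratic form is positive. In the
same way `φ(p_1) = 1` for all vector states means that `π(1)` has the quadratic form of the
identity, so that `π(1) = 1`.

For the involution, let `γ ∈ C(k ⊗ x, y ⊗ k)`. Its double rotation first uses `(R_k, R̄_k)` and
then the solution chosen for `k̄`. If the latter were `(R̄_k, R_k)`, the result would be `γ` by the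
conjugate equations (`rotateWith_rotateWith`). In general the representative of the conjugate of
`k̄` is `k`, by uniqueness of duals (`IrrSystem.conj_conj`), and as `k` and `k̄` are simple, the
solution for `k̄` is `(c R̄_k, c' R_k)` with scalars `c`, `c'` (`IsConjugateSolution.exists_eq_smul`).
The conjugate equations force `c' c̄ = 1`, and this is exactly the factor by which the double
rotation changes (`rotateWith_rotateWith_of_simple`).
-/

namespace TubeAlgebra

open CStarCategory (dag)

theorem dag_zero {C : Type u} [Category.{v} C] [Preadditive C] [Linear ℂ C] [CStarCategory C]
    {X Y : C} : dag (0 : X ⟶ Y) = 0 := by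
  simpa using CStarCategory.dag_smul (0 : ℂ) (0 : X ⟶ Y)

/-! ### Solutions of the conjugate equations and rotation of morphisms -/

section Duality

variable {C : Type u} [Category.{v} C] [Preadditive C] [Linear ℂ C]
  [MonoidalCategory C] [MonoidalPreadditive C] [MonoidalLinear ℂ C]
  [CStarTensorCategory C]

theorem dag_associator_inv (X Y Z : C) : dag (α_ X Y Z).inv = (α_ X Y Z).hom := by
  rw [← CStarTensorCategory.dag_associator, CStarCategory.dag_dag]

theorem dag_rightUnitor_inv (X : C) : dag (ρ_ X).inv = (ρ_ X).hom := by
  rw [← CStarTensorCategory.dag_rightUnitor, CStarCategory.dag_dag]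

variable {X Xb : C} {R : 𝟙_ C ⟶ Xb ⊗ X} {Rb : 𝟙_ C ⟶ X ⊗ Xb}

theorem IsConjugateSolution.symm (h : IsConjugateSolution R Rb) : IsConjugateSolution Rb R :=
  ⟨h.2, h.1⟩

theorem IsConjugateSolution.zigzag (h : IsConjugateSolution R Rb) :
    R ▷ Xb ≫ (α_ Xb X Xb).hom ≫ Xb ◁ dag Rb = (λ_ Xb).hom ≫ (ρ_ Xb).inv := by
  have := h.1
  rw [Iso.inv_comp_eq, Category.comp_id] at this
  rw [← this]; simp

theorem IsConjugateSolution.zigzag_dag (h : IsConjugateSolution R Rb) :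
    Xb ◁ Rb ≫ (α_ Xb X Xb).inv ≫ dag R ▷ Xb = (ρ_ Xb).hom ≫ (λ_ Xb).inv := by
  simpa [CStarCategory.dag_comp, CStarTensorCategory.dag_whiskerLeft,
    CStarTensorCategory.dag_whiskerRight, CStarTensorCategory.dag_associator,
    CStarTensorCategory.dag_leftUnitor, dag_rightUnitor_inv, CStarCategory.dag_dag] using
    congrArg dag h.zigzag

/-- A solution of the conjugate equations exhibits `Xb` as a dual of `X`, with coevaluation `Rb`
and evaluation `R*`. -/
@[reducible]
def IsConjugateSolution.exactPairing (h : IsConjugateSolution R Rb) : ExactPairing X Xb where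
  coevaluation' := Rb
  evaluation' := dag R
  coevaluation_evaluation' := h.zigzag_dag
  evaluation_coevaluation' := h.symm.zigzag

/-- By Frobenius reciprocity `C(1, X ⊗ Xb) ≅ C(X, X)`, which is spanned by the identity of the
simple object `X`, corresponding to `Rb`. -/
theorem IsConjugateSolution.exists_eq_smul (h : IsConjugateSolution R Rb)
    (hX : IsSimpleObject X) (T : 𝟙_ C ⟶ X ⊗ Xb) : ∃ c : ℂ, T = c • Rb := by
  let _ : ExactPairing X Xb := h.exactPairing
  obtain ⟨c, hc⟩ := hX.2 ((λ_ X).inv ≫ (tensorRightHomEquiv (𝟙_ C) X Xb X).symm T)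
  refine ⟨c, ?_⟩
  rw [Iso.inv_comp_eq] at hc
  rw [Equiv.symm_apply_eq] at hc
  rw [hc]
  simp [tensorRightHomEquiv, ExactPairing.coevaluation, unitors_equal]
  rfl

/-- The morphism `(R* ⊗ 1)(1 ⊗ γ* ⊗ 1)(1 ⊗ Rb)`. It is `rotate` with the pair of objects and the
pair of morphisms left free, so that rotating twice can be studied without identifying `k` with
the chosen conjugate of its conjugate. -/
def rotateWith {x y k kb : C} (R : 𝟙_ C ⟶ kb ⊗ k) (Rb : 𝟙_ C ⟶ k ⊗ kb)
    (γ : k ⊗ x ⟶ y ⊗ k) : kb ⊗ y ⟶ x ⊗ kb :=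
  kb ◁ ((ρ_ y).inv ≫ y ◁ Rb ≫ (α_ y k kb).inv ≫ dag γ ▷ kb ≫ (α_ k x kb).hom) ≫
    (α_ kb k (x ⊗ kb)).inv ≫ dag R ▷ (x ⊗ kb) ≫ (λ_ (x ⊗ kb)).hom

/-- Rotating twice with the two morphisms exchanged straightens the string labelled `X` on both
sides of `γ`. -/
theorem rotateWith_rotateWith {x y : C} (h : IsConjugateSolution R Rb) (γ : X ⊗ x ⟶ y ⊗ X) :
    rotateWith Rb R (rotateWith R Rb γ) = γ := by
  have zigzag := h.symm.zigzag_dag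
  simp only [rotateWith, CStarCategory.dag_comp, CStarTensorCategory.dag_whiskerLeft,
    CStarTensorCategory.dag_whiskerRight, CStarTensorCategory.dag_associator,
    CStarTensorCategory.dag_leftUnitor, dag_rightUnitor_inv, dag_associator_inv,
    CStarCategory.dag_dag]
  -- The interchange law moves the first `R` after the second one and after `γ`, next to `Rb*`,
  -- where it straightens; then the other `Rb*` moves before `γ` and straightens with the other `R`.
  calc
    _ = 𝟙 _ ⊗≫ X ◁ (((𝟙_ C) ⊗ x) ◁ R ≫ (R ▷ x) ▷ (Xb ⊗ X)) ⊗≫ X ◁ Xb ◁ γ ▷ Xb ▷ X ⊗≫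
        (X ◁ Xb ◁ y ◁ dag Rb) ▷ X ⊗≫ dag Rb ▷ (y ⊗ X) ⊗≫ 𝟙 _ := by monoidal
    _ = 𝟙 _ ⊗≫ X ◁ R ▷ x ⊗≫ X ◁ Xb ◁ ((X ⊗ x) ◁ R ≫ γ ▷ (Xb ⊗ X)) ⊗≫
        (X ◁ Xb ◁ y ◁ dag Rb) ▷ X ⊗≫ dag Rb ▷ (y ⊗ X) ⊗≫ 𝟙 _ := by
      rw [whisker_exchange]; monoidal
    _ = 𝟙 _ ⊗≫ X ◁ R ▷ x ⊗≫ X ◁ Xb ◁ γ ⊗≫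
        (X ⊗ Xb ⊗ y) ◁ (X ◁ R ≫ (α_ X Xb X).inv ≫ dag Rb ▷ X) ⊗≫
        dag Rb ▷ (y ⊗ X) ⊗≫ 𝟙 _ := by
      rw [whisker_exchange]; monoidal
    _ = 𝟙 _ ⊗≫ X ◁ R ▷ x ⊗≫ ((X ⊗ Xb) ◁ γ ≫ dag Rb ▷ (y ⊗ X)) ⊗≫ 𝟙 _ := by
      rw [zigzag]; monoidal
    _ = 𝟙 _ ⊗≫ (X ◁ R ≫ (α_ X Xb X).inv ≫ dag Rb ▷ X) ▷ x ⊗≫ γ ⊗≫ 𝟙 _ := by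
      rw [whisker_exchange]; monoidal
    _ = γ := by
      rw [zigzag]; monoidal

theorem rotateWith_zero {x y k kb : C} (R : 𝟙_ C ⟶ kb ⊗ k) (Rb : 𝟙_ C ⟶ k ⊗ kb) :
    rotateWith R Rb (0 : k ⊗ x ⟶ y ⊗ k) = 0 := by
  simp [rotateWith, dag_zero]

theorem rotateWith_add {x y k kb : C} (R : 𝟙_ C ⟶ kb ⊗ k) (Rb : 𝟙_ C ⟶ k ⊗ kb)
    (γ δ : k ⊗ x ⟶ y ⊗ k) :
    rotateWith R Rb (γ + δ) = rotateWith R Rb γ + rotateWith R Rb δ := by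
  simp [rotateWith, CStarCategory.dag_add]

theorem rotateWith_smul_smul {x y k kb : C} (R : 𝟙_ C ⟶ kb ⊗ k) (Rb : 𝟙_ C ⟶ k ⊗ kb)
    (c c' : ℂ) (γ : k ⊗ x ⟶ y ⊗ k) :
    rotateWith (c • R) (c' • Rb) γ = (c' * starRingEnd ℂ c) • rotateWith R Rb γ := by
  simp [rotateWith, CStarCategory.dag_smul, smul_smul, mul_comm]

/-- Two solutions for the same pair of simple objects, taken in opposite order, differ by scalars
that cancel in the rotation. -/
theorem rotateWith_rotateWith_of_simple {x y : C} (h : IsConjugateSolution R Rb)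
    (hX : IsSimpleObject X) (hXb : IsSimpleObject Xb) {R' : 𝟙_ C ⟶ X ⊗ Xb} {Rb' : 𝟙_ C ⟶ Xb ⊗ X}
    (h' : IsConjugateSolution R' Rb') (γ : X ⊗ x ⟶ y ⊗ X) :
    rotateWith R' Rb' (rotateWith R Rb γ) = γ := by
  obtain ⟨c, rfl⟩ := h.exists_eq_smul hX R'
  obtain ⟨c', rfl⟩ := h.symm.exists_eq_smul hXb Rb'
  have hc : (c * starRingEnd ℂ c') • 𝟙 X = (1 : ℂ) • 𝟙 X := by
    have e := h'.1
    have e0 := h.2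
    simp only [CStarCategory.dag_smul, MonoidalLinear.smul_whiskerRight,
      MonoidalLinear.whiskerLeft_smul, Linear.smul_comp, Linear.comp_smul, e0, smul_smul] at e
    rw [one_smul, mul_comm, e]
  have hc1 : c * starRingEnd ℂ c' = 1 := smul_left_injective ℂ hX.1 hc
  have hc2 : c' * starRingEnd ℂ c = 1 := by
    simpa [mul_comm] using congrArg (starRingEnd ℂ) hc1
  rw [rotateWith_smul_smul, hc2, one_smul, rotateWith_rotateWith h]

end Duality

/-! ### The involution of the tube algebra -/

section Involution

variable {C : Type u} [Category.{v} C] [Preadditive C] [Linear ℂ C]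
  [MonoidalCategory C] [MonoidalPreadditive C] [MonoidalLinear ℂ C]
  [RigidCStarTensorCategory C] {S : IrrSystem C}

theorem IrrSystem.conj_conj (S : IrrSystem C) (k : S.Irr) : S.conj (S.conj k) = k := by
  let p : ExactPairing (S.conj (S.conj k) : C) (S.conj k : C) :=
    (S.standard (S.conj k)).1.symm.exactPairing
  let q : ExactPairing (k : C) (S.conj k : C) := (S.standard k).1.exactPairing
  exact Subtype.ext (S.eq_of_iso _ (S.conj (S.conj k)).2 _ k.2 ⟨leftDualIso p q⟩)

theorem rotate_eq_rotateWith {x y : C} (k : S.Irr) (γ : (k : C) ⊗ x ⟶ y ⊗ (k : C)) :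
    rotate k γ = rotateWith (S.R k) (S.Rbar k) γ := rfl

open scoped Classical in
theorem tubeStar_single {x y : C} (k : S.Irr) (γ : (k : C) ⊗ x ⟶ y ⊗ (k : C)) :
    tubeStar (DFinsupp.single k γ : Tube S x y) = DFinsupp.single (S.conj k) (rotate k γ) := by
  refine DFinsupp.sum_single_index
    (h := fun (k : S.Irr) (γ : (k : C) ⊗ x ⟶ y ⊗ (k : C)) ↦
      (DFinsupp.single (S.conj k) (rotate k γ) : Tube S y x)) ?_
  rw [rotate_eq_rotateWith, rotateWith_zero, DFinsupp.single_zero]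

open scoped Classical in
theorem tubeStar_add {x y : C} (a b : Tube S x y) : tubeStar (a + b) = tubeStar a + tubeStar b := by
  refine DFinsupp.sum_add_index
    (h := fun (k : S.Irr) (γ : (k : C) ⊗ x ⟶ y ⊗ (k : C)) ↦
      (DFinsupp.single (S.conj k) (rotate k γ) : Tube S y x))
    (fun k ↦ ?_) (fun k γ δ ↦ ?_)
  · rw [rotate_eq_rotateWith, rotateWith_zero, DFinsupp.single_zero]
  · rw [rotate_eq_rotateWith, rotateWith_add, DFinsupp.single_add]; rfl

open scoped Classical in
theorem tubeStar_tubeStar {x y : C} (a : Tube S x y) : tubeStar (tubeStar a) = a := by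
  induction a using DFinsupp.induction with
  | h0 => simp [tubeStar]
  | ha k γ a _ _ ih =>
    rw [tubeStar_add, tubeStar_add, ih, tubeStar_single, tubeStar_single]
    congr 1
    -- The component of the left-hand side sits at the index `conj (conj k)`, only propositionally
    -- equal to `k`; abstracting that index lets the equality be substituted.
    have key : ∀ (j : S.Irr) (_ : j = k) (R' : 𝟙_ C ⟶ (j : C) ⊗ (S.conj k : C))
        (Rb' : 𝟙_ C ⟶ (S.conj k : C) ⊗ (j : C)), IsConjugateSolution R' Rb' →
        (DFinsupp.single j (rotateWith R' Rb' (rotate k γ)) : Tube S x y)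
          = DFinsupp.single k γ := by
      rintro j rfl R' Rb' h'
      rw [rotate_eq_rotateWith, rotateWith_rotateWith_of_simple (S.standard j).1
        (S.simple _ j.2) (S.simple _ (S.conj j).2) h']
    exact key _ (S.conj_conj k) _ _ (S.standard (S.conj k)).1

end Involution

/-! ### Vector functionals and positivity -/

section Representations

variable {C : Type u} [Category.{v} C] [Preadditive C] [Linear ℂ C]
  [MonoidalCategory C] [MonoidalPreadditive C] [MonoidalLinear ℂ C]
  [RigidCStarTensorCategory C] {S : IrrSystem C}
  {H : Type w} [NormedAddCommGroup H] [InnerProductSpace ℂ H] [CompleteSpace H]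

open scoped Classical in
/-- The identification of `ℂ[C]` with `A_{1,1}` sends `[k]` to `1_k`. -/
theorem fusionEquiv_basis (k : S.Irr) :
    fusionEquiv S (FusionAlgebra.basis k) = DFinsupp.single k (unitBox (k : C)) := by
  change DFinsupp.mapRange _ (fun _ ↦ map_zero _)
    (Finsupp.toDFinsupp (Finsupp.single k (1 : ℂ))) = _
  rw [Finsupp.toDFinsupp_single, DFinsupp.mapRange_single]
  exact congrArg _ (one_smul ℂ _)

open scoped Classical in
theorem fusionEquiv_one : fusionEquiv S 1 = tubeProj S (𝟙_ C) := by
  have h : unitBox (𝟙_ C) = (λ_ (𝟙_ C)).hom ≫ (ρ_ (𝟙_ C)).inv := by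
    rw [unitBox, ← unitors_equal, unitors_inv_equal]
  exact (fusionEquiv_basis S.unit).trans (congrArg (DFinsupp.single S.unit) h)

theorem vectorFunctional_fusionEquiv (π : FusionAlgebra S →⋆ₙₐ[ℂ] (H →L[ℂ] H)) (ξ : H)
    (y : FusionAlgebra S) : vectorFunctional π ξ (fusionEquiv S y) = inner ℂ ξ (π y ξ) := by
  simp [vectorFunctional]

theorem vectorFunctional_smul (π : FusionAlgebra S →⋆ₙₐ[ℂ] (H →L[ℂ] H)) (c : ℂ) (ξ : H)
    (a : Tube S (𝟙_ C) (𝟙_ C)) :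
    vectorFunctional π (c • ξ) a = (‖c‖ : ℂ) ^ 2 * vectorFunctional π ξ a := by
  simp only [vectorFunctional, LinearMap.coe_mk, AddHom.coe_mk, map_smul, inner_smul_left,
    inner_smul_right, ← mul_assoc, ← Complex.mul_conj']

/-- The functional of a non-zero vector is a positive multiple of a vector state. -/
theorem exists_vectorFunctional_eq_mul (π : FusionAlgebra S →⋆ₙₐ[ℂ] (H →L[ℂ] H)) {ξ : H}
    (hξ : ξ ≠ 0) : ∃ u : H, ‖u‖ = 1 ∧
      ∀ a, vectorFunctional π ξ a = (‖ξ‖ : ℂ) ^ 2 * vectorFunctional π u a := by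
  refine ⟨(‖ξ‖⁻¹ : ℂ) • ξ, norm_smul_inv_norm hξ, fun a ↦ ?_⟩
  have h : (‖ξ‖ : ℂ) ≠ 0 := by simpa using hξ
  rw [vectorFunctional_smul, ← mul_assoc]
  simp [h]

theorem IsAdmissible.map_one {π : FusionAlgebra S →⋆ₙₐ[ℂ] (H →L[ℂ] H)} (h : IsAdmissible π) :
    π 1 = 1 := by
  rw [← ContinuousLinearMap.coe_inj, ← ext_inner_map]
  intro ξ
  rcases eq_or_ne ξ 0 with rfl | hξ
  · simp
  obtain ⟨u, hu, hξu⟩ := exists_vectorFunctional_eq_mul π hξ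
  have h1 : inner ℂ ξ (π 1 ξ) = (‖ξ‖ : ℂ) ^ 2 := by
    rw [← vectorFunctional_fusionEquiv, hξu, fusionEquiv_one, (h u hu).1, mul_one]
  rw [← inner_conj_symm]
  simp [h1, inner_self_eq_norm_sq_to_K]

theorem IsAdmissible.vectorFunctional_nonneg {π : FusionAlgebra S →⋆ₙₐ[ℂ] (H →L[ℂ] H)}
    (h : IsAdmissible π) (ξ : H) (m : S.Irr) (f : Tube S (𝟙_ C) (m : C)) :
    0 ≤ vectorFunctional π ξ (tubeMul (tubeStar f) f) := by
  rcases eq_or_ne ξ 0 with rfl | hξ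
  · simp [vectorFunctional]
  obtain ⟨u, hu, hξu⟩ := exists_vectorFunctional_eq_mul π hξ
  rw [hξu]
  exact mul_nonneg (by positivity) ((h u hu).2 m f)

theorem IsAdmissible.isTubePositive {π : FusionAlgebra S →⋆ₙₐ[ℂ] (H →L[ℂ] H)}
    (h : IsAdmissible π) : IsTubePositive π := by
  refine ⟨h.map_one, ?_⟩
  rintro y ⟨n, x, a, hy⟩
  have key : ∀ ξ : H, 0 ≤ inner ℂ ξ (π y ξ) := by
    intro ξ
    rw [← vectorFunctional_fusionEquiv, hy, map_sum]
    refine Finset.sum_nonneg fun i _ ↦ ?_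
    simpa only [tubeStar_tubeStar] using h.vectorFunctional_nonneg ξ (x i) (tubeStar (a i))
  rw [ContinuousLinearMap.isPositive_iff_complex]
  intro ξ
  have hξ : 0 ≤ inner ℂ (π y ξ) ξ := by
    rw [← inner_conj_symm]
    exact star_nonneg_iff.mpr (key ξ)
  obtain ⟨hre, him⟩ := Complex.nonneg_iff.mp hξ
  exact ⟨Complex.ext (by simp) (by simpa using him), hre⟩

theorem IsTubePositive.isAdmissible {π : FusionAlgebra S →⋆ₙₐ[ℂ] (H →L[ℂ] H)}
    (h : IsTubePositive π) : IsAdmissible π := by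
  refine fun ξ hξ ↦ ⟨?_, fun m f ↦ ?_⟩
  · rw [← fusionEquiv_one, vectorFunctional_fusionEquiv, h.1]
    simp [inner_self_eq_norm_sq_to_K, hξ]
  · have hy : (fusionEquiv S).symm (tubeMul (tubeStar f) f) ∈ tubeCone S :=
      ⟨1, fun _ ↦ m, fun _ ↦ tubeStar f, by simp [tubeStar_tubeStar]⟩
    exact (h.2 _ hy).inner_nonneg_right ξ

end Representations
end TubeAlgebra

theorem mainTheorem6 {C : Type u} [Category.{v} C] [Preadditive C] [Linear ℂ C]
    [MonoidalCategory C] [MonoidalPreadditive C] [MonoidalLinear ℂ C]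
    [TubeAlgebra.RigidCStarTensorCategory C]
    (hunit : TubeAlgebra.IsSimpleObject (𝟙_ C))
    (S : TubeAlgebra.IrrSystem C) (hcount : S.Irr.Countable)
    {H : Type w} [NormedAddCommGroup H] [InnerProductSpace ℂ H] [CompleteSpace H]
    (π : TubeAlgebra.FusionAlgebra S →⋆ₙₐ[ℂ] (H →L[ℂ] H))
    (hπ : TubeAlgebra.IsNonDegenerate π) :
    TubeAlgebra.IsAdmissible π ↔ TubeAlgebra.IsTubePositive π :=
  ⟨TubeAlgebra.IsAdmissible.isTubePositive, TubeAlgebra.IsTubePositive.isAdmissible⟩
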